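/- Let $G$ be a finitely generated (discrete) group with at least two ends, i.e. such that its Cayley graph with respect to some (equivalently, every) finite generating set has at least two ends. Let $G$ act by homeomorphisms on a nonempty compact metrizable space $X$, let $d$ be a compatible metric on $X$, and suppose the action is expansive with expansiveness constant $\delta>0$: for all $x\neq y$ in $X$ there is $g\in G$ with $d(gx,gy)>\delta$. Suppose the action has the cover strong topological Markov property (with respect to $d$ and $\delta$): there is a finite symmetric set $S\subseteq G$ containing the unit such that for every cover $(F_n)_{n\in\mathbb N}$ of $G$ by pairwise disjoint (possibly empty or infinite) sets and every sequence $(x_n)_{n\in\mathbb N}$ in $X$ satisfying $d(gx_n,gx_m)\le\delta/2$ for all $n\ne m$ and all $g\in SF_n\cap F_m$, there exists $z\in X$ with $d(gz,gx_n)\le\delta/2$ for all $n$ and all $g\in F_n$. Then $X$ has a weakly periodic point, i.e. a point whose stabilizer in $G$ is infinite. If, moreover, the action has the weak specification property, i.e. for every $\varepsilon>0$ there is a finite symmetric set $S\subseteq G$ such that for all $A_1,A_2\subseteq G$ with $SA_1\cap A_2=\emptyset$ and all $x_1,x_2\in X$ there is $y\in X$ with $d(gx_i,gy)<\varepsilon$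 for $i\in\{1,2\}$ and all $g\in A_i$, then the set of weakly periodic points is dense in $X$. -/

import Mathlib

open Pointwise

/-- A finitely generated group has at least two ends: the Cayley graph with respect to some finite
generating set (equivalently, any) has at least two ends. -/
def HasAtLeastTwoEnds (G : Type*) [Group G] : Prop :=
  ∃ T : Set G, T.Finite ∧ Subgroup.closure T = ⊤ ∧ 2 ≤ (SimpleGraph.mulCayley T).end.encard

/-- `δ` is an expansiveness constant for the action of `G` on the metric space `X`. -/
def IsExpansivenessConstant (G X : Type*) [Group G] [MetricSpace X] [MulAction G X]
    (δ : ℝ) : Prop :=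
  0 < δ ∧ ∀ x y : X, x ≠ y → ∃ g : G, δ < dist (g • x) (g • y)

/-- The cover strong topological Markov property, with respect to the metric of `X` and the
expansiveness constant `δ`. Members of the cover `F` are allowed to be empty, so that finite
covers are included. -/
def CoverStrongTopologicalMarkov (G X : Type*) [Group G] [MetricSpace X] [MulAction G X]
    (δ : ℝ) : Prop :=
  ∃ S : Set G, S.Finite ∧ S⁻¹ = S ∧ 1 ∈ S ∧
    ∀ F : ℕ → Set G, Pairwise (fun n m => Disjoint (F n) (F m)) → (⋃ n, F n) = Set.univ →
      ∀ x : ℕ → X,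
        (∀ n m, n ≠ m → ∀ g ∈ (S * F n) ∩ F m, dist (g • x n) (g • x m) ≤ δ / 2) →
        ∃ z : X, ∀ n, ∀ g ∈ F n, dist (g • z) (g • x n) ≤ δ / 2

/-- The weak specification property. -/
def WeakSpecification (G X : Type*) [Group G] [MetricSpace X] [MulAction G X] : Prop :=
  ∀ ε : ℝ, 0 < ε → ∃ S : Set G, S.Finite ∧ S⁻¹ = S ∧
    ∀ (A₁ A₂ : Set G) (x₁ x₂ : X), (S * A₁) ∩ A₂ = ∅ →
      ∃ y : X, (∀ g ∈ A₁, dist (g • x₁) (g • y) < ε) ∧ (∀ g ∈ A₂, dist (g • x₂) (g • y) < ε)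

/-- A point is weakly periodic if its stabilizer is infinite. -/
def IsWeaklyPeriodic (G : Type*) {X : Type*} [Group G] [MulAction G X] (x : X) : Prop :=
  (MulAction.stabilizer G x : Set G).Infinite

/-!
Work with the configurations `g ↦ g • x`, which `G` shifts by right multiplication, and call a set
`E ⊆ G` a half-space when `E` and its complement are infinite and only finitely many points are
moved across `E` by *left* multiplication by a generator. Two ends give a half-space, namely the
inverse of a component of the complement of a finite set in the Cayley graph
(`exists_halfSpace`). A half-space of `G` is strictly nested inside itself by some right
translation `h` (`exists_isNestedBy`): for `g` outside a finite set, the boundary of `E` lies on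
one side of `E * g` and the boundary of `E * g` lies on one side of `E`, so that `E` and `E * g`
are nested up to complements, and two flips compose to a genuine inclusion.

The differences of consecutive sets in the chain `⋯ ⊇ E h⁻¹ ⊇ E ⊇ E h ⊇ ⋯` partition `G`.
If `x` and `h • x` agree up to `δ / 2` along the finite boundary of `E`, the pieces of `x` over
`E \ E h`, translated by the powers of `h`, can be glued by the Markov property, and expansiveness
makes the resulting point invariant under `h` (`exists_smul_eq_of_boundary_close`). By compactness
such an agreement always occurs after replacing `h` by a power and `x` by a translate
(`exists_periodic`). With weak specification, one first glues a prescribed point, on a large finite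
set, to a point fixed by `h` along the boundaries of `E h⁻ᵐ` and `E hᵐ`; periodizing the result
changes it little near the identity, whence density.
-/

open Filter Topology

/-! ### Half-spaces and ends -/

section HalfSpaces

variable {G : Type*} [Group G]

/-- The two-sided boundary of `E` for the edges `v — s * v`, `s ∈ W`: the points of `G` that some
element of `W` moves from one side of `E` to the other. -/
def leftBoundary (W E : Set G) : Set G := {v | ∃ s ∈ W, ¬(v ∈ E ↔ s * v ∈ E)}

theorem leftBoundary_compl (W E : Set G) : leftBoundary W Eᶜ = leftBoundary W E := by
  ext v
  simp only [leftBoundary, Set.mem_ofPred_eq, Set.mem_compl_iff, not_iff_not]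

theorem mul_mem_leftBoundary {W E : Set G} (hW : ∀ s ∈ W, s⁻¹ ∈ W) {v s : G} (hs : s ∈ W)
    (h : ¬(v ∈ E ↔ s * v ∈ E)) : s * v ∈ leftBoundary W E :=
  ⟨s⁻¹, hW s hs, by rw [inv_mul_cancel_left]; tauto⟩

/-- The Cayley graph of a symmetric generating set is connected: a set with empty boundary is
empty or everything. -/
theorem mem_of_forall_mul_mem {W U : Set G} (hW : ∀ s ∈ W, s⁻¹ ∈ W)
    (hgen : Subgroup.closure W = ⊤) (hU : ∀ s ∈ W, ∀ g ∈ U, s * g ∈ U) {a : G} (ha : a ∈ U)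
    (b : G) : b ∈ U := by
  have key : ∀ c : G, ∀ g ∈ U, c * g ∈ U := by
    intro c
    have hc : c ∈ Subgroup.closure W := hgen ▸ Subgroup.mem_top c
    rw [← Subgroup.mem_toSubmonoid, Subgroup.closure_toSubmonoid] at hc
    induction hc using Submonoid.closure_induction with
    | mem s hs =>
      rcases hs with hs | hs
      · exact hU s hs
      · exact hU s (by simpa using hW _ hs)
    | one => simp
    | mul a b _ _ iha ihb =>
      intro g hg
      rw [mul_assoc]
      exact iha _ (ihb g hg)
  simpa using key (b * a⁻¹) a ha

/-- Almost invariance under a generating set propagates to the whole group. -/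
theorem finite_setOf_not_mem_iff {W E : Set G} (hgen : Subgroup.closure W = ⊤)
    (hE : (leftBoundary W E).Finite) (b : G) : {v | ¬(v ∈ E ↔ b * v ∈ E)}.Finite := by
  have hb : b ∈ Subgroup.closure W := hgen ▸ Subgroup.mem_top b
  induction hb using Subgroup.closure_induction with
  | mem s hs => exact hE.subset fun v hv => ⟨s, hs, hv⟩
  | one => simp
  | mul a b _ _ iha ihb =>
    refine (ihb.union (iha.preimage (f := fun v => b * v)
      (mul_right_injective b).injOn)).subset fun v hv => ?_
    simp only [Set.mem_union, Set.mem_preimage, Set.mem_ofPred_eq, mul_assoc] at hv ⊢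
    tauto
  | inv b _ ihb =>
    refine (ihb.preimage (f := fun v => b⁻¹ * v)
      (mul_right_injective b⁻¹).injOn).subset fun v hv => ?_
    simp only [Set.mem_preimage, Set.mem_ofPred_eq, mul_inv_cancel_left] at hv ⊢
    tauto

/-- A group with at least two ends contains a half-space. -/
theorem exists_halfSpace (hends : HasAtLeastTwoEnds G) :
    ∃ E : Set G, E.Infinite ∧ Eᶜ.Infinite ∧ ∀ b : G, {v | ¬(v ∈ E ↔ b * v ∈ E)}.Finite := by
  obtain ⟨T, hT, hgen, hends⟩ := hends
  obtain ⟨e, e', he, he', hne⟩ := Set.one_lt_encard_iff.1 (lt_of_lt_of_le (by norm_num) hends)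
  obtain ⟨K, hK⟩ := Function.ne_iff.1 hne
  have hinf : ∀ e ∈ (SimpleGraph.mulCayley T).end,
      (SimpleGraph.ComponentCompl.supp (e K)).Infinite := by
    intro e he
    refine (SimpleGraph.ComponentCompl.infinite_iff_in_all_ranges (e K)).2 fun L hL => ?_
    exact ⟨e (Opposite.op L), he (CategoryTheory.opHomOfLE hL : Opposite.op L ⟶ K)⟩
  set C := SimpleGraph.ComponentCompl.supp (e K) with hC
  have hdisj : SimpleGraph.ComponentCompl.supp (e' K) ⊆ Cᶜ := fun v hv hv' =>
    Set.disjoint_left.1 (SimpleGraph.ComponentCompl.pairwise_disjoint hK) hv' hv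
  -- Mathlib's Cayley graph has edges `v — v * t`, whence the inversion.
  refine ⟨C⁻¹, Set.infinite_inv.2 (hinf e he), ?_, finite_setOf_not_mem_iff hgen ?_⟩
  · rw [← Set.compl_inv]
    exact Set.infinite_inv.2 ((hinf e' he').mono hdisj)
  -- An edge leaving a component of the complement of `K` ends in `K`.
  have hstep : ∀ u v, u ∈ C → v ∉ C → (SimpleGraph.mulCayley T).Adj u v → v ∈ K.unop := by
    intro u v hu hv huv
    by_contra hvK
    exact hv (SimpleGraph.ComponentCompl.mem_of_adj u v hu hvK huv)
  have hKfin : ((K.unop : Set G)⁻¹).Finite := K.unop.finite_toSet.inv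
  refine (hKfin.union (hT.biUnion fun t _ => hKfin.preimage (f := fun v => t * v)
    (mul_right_injective t).injOn)).subset ?_
  rintro v ⟨t, ht, hv⟩
  simp only [Set.mem_inv, mul_inv_rev] at hv
  have hadj : (SimpleGraph.mulCayley T).Adj v⁻¹ (v⁻¹ * t⁻¹) := by
    rw [SimpleGraph.mulCayley_adj]
    refine ⟨fun h => hv (by rw [← h]), Or.inr ?_⟩
    simpa using ht
  by_cases h : v⁻¹ ∈ C
  · refine Or.inr (Set.mem_biUnion ht ?_)
    simpa using hstep _ _ h (by tauto) hadj
  · exact Or.inl (hstep _ _ (by tauto) h hadj.symm)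

/-- If the boundary of `E` lies in `D` and the boundary of `D` lies in `E`, then `E` and `D`
cover `G`, unless both are empty. -/
theorem mem_of_leftBoundary_subset {W D E : Set G} (hW : ∀ s ∈ W, s⁻¹ ∈ W)
    (hgen : Subgroup.closure W = ⊤) (hE : leftBoundary W E ⊆ D) (hD : leftBoundary W D ⊆ E)
    {a : G} (ha : a ∈ E) {g : G} (hg : g ∉ E) : g ∈ D := by
  by_contra hgD
  refine (mem_of_forall_mul_mem (U := Eᶜ ∩ Dᶜ) hW hgen ?_ ⟨hg, hgD⟩ a).1 ha
  rintro s hs u ⟨huE, huD⟩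
  refine ⟨fun h => huD (hE ⟨s, hs, ?_⟩), fun h => huE (hD ⟨s, hs, ?_⟩)⟩
  · exact fun hiff => huE (hiff.2 h)
  · exact fun hiff => huD (hiff.2 h)

theorem leftBoundary_preimage_mul_right (W E : Set G) (g : G) :
    leftBoundary W ((· * g) ⁻¹' E) = (· * g) ⁻¹' leftBoundary W E := by
  ext v
  simp [leftBoundary, mul_assoc]

theorem exists_mem_leftBoundary_mem {W E : Set G} (hW : ∀ s ∈ W, s⁻¹ ∈ W)
    (hgen : Subgroup.closure W = ⊤) (hE : E.Nonempty) (hEc : Eᶜ.Nonempty) :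
    ∃ v ∈ leftBoundary W E, v ∈ E := by
  by_contra! hcon
  obtain ⟨a, ha⟩ := hE
  obtain ⟨b, hb⟩ := hEc
  refine hb (mem_of_forall_mul_mem hW hgen (fun s hs g hg => ?_) ha b)
  by_contra h
  exact hcon g ⟨s, hs, fun hiff => h (hiff.1 hg)⟩ hg

/-- `E` is a set with finite boundary with respect to the symmetric generating set `W`, and right
translation by `h` maps `E` strictly into itself. -/
structure IsNestedBy (W E : Set G) (h : G) : Prop where
  inv_mem : ∀ s ∈ W, s⁻¹ ∈ W
  closure_eq : Subgroup.closure W = ⊤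
  finite_leftBoundary : (leftBoundary W E).Finite
  mul_mem : ∀ g ∈ E, g * h ∈ E
  exists_notMem : ∃ g ∈ E, g * h⁻¹ ∉ E

/-- Every half-space is strictly nested inside itself by some right translation. -/
theorem exists_isNestedBy {W E : Set G} (hW : ∀ s ∈ W, s⁻¹ ∈ W)
    (hgen : Subgroup.closure W = ⊤) (hfin : (leftBoundary W E).Finite) (hE : E.Infinite)
    (hEc : Eᶜ.Infinite) : ∃ h : G, IsNestedBy W E h := by
  have hinv := finite_setOf_not_mem_iff hgen hfin
  -- For `g` outside `N₀`, the translate `leftBoundary W E * g` does not meet both `E` and `Eᶜ`.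
  let N₀ : Set G := ⋃ b ∈ leftBoundary W E, {v | ¬(v ∈ E ↔ b * v ∈ E)}
  have hN₀ : N₀.Finite := hfin.biUnion fun b _ => hinv b
  have hside : ∀ v, v ∉ N₀ → ∀ b ∈ leftBoundary W E, (b * v ∈ E ↔ v ∈ E) := by
    intro v hv b hb
    by_contra h
    exact hv (Set.mem_biUnion hb fun h' => h h'.symm)
  have hN : (N₀ ∪ N₀⁻¹).Finite := hN₀.union hN₀.inv
  have hpre : ∀ (g : G) (D : Set G), (∀ b ∈ leftBoundary W E, b * g ∈ D) →
      leftBoundary W ((· * g⁻¹) ⁻¹' E) ⊆ D := by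
    intro g D H b hb
    rw [leftBoundary_preimage_mul_right] at hb
    simpa using H _ hb
  obtain ⟨a, ha⟩ := hE.nonempty
  obtain ⟨a', ha'⟩ := hEc.nonempty
  obtain ⟨b, hb, hbE⟩ : ∃ b ∈ leftBoundary W E, b ∈ Eᶜ := by
    rw [← leftBoundary_compl]
    exact exists_mem_leftBoundary_mem hW hgen ⟨a', ha'⟩ ⟨a, not_not.2 ha⟩
  by_cases hcase : ∃ g ∈ E, g ∉ N₀ ∪ N₀⁻¹ ∧ g⁻¹ ∉ E
  · obtain ⟨g, hg, hgN, hg'⟩ := hcase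
    have h₁ : g ∉ N₀ := fun h => hgN (Or.inl h)
    have h₂ : g⁻¹ ∉ N₀ := fun h => hgN (Or.inr h)
    refine ⟨g, hW, hgen, hfin, fun x hx => ?_, b * g, (hside g h₁ b hb).2 hg, by simpa using hbE⟩
    by_contra hxg
    refine mem_of_leftBoundary_subset (D := ((· * g⁻¹) ⁻¹' E)ᶜ) hW hgen ?_ ?_ ha hxg
      (by simpa using hx)
    · exact fun c hc hcg => hg' ((hside _ h₂ c hc).1 hcg)
    · rw [leftBoundary_compl]
      exact hpre g E fun c hc => (hside g h₁ c hc).2 hg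
  · push Not at hcase
    obtain ⟨g, hg, hgN⟩ := hE.exists_notMem_finite hN
    obtain ⟨k, hk, hkN⟩ := hEc.exists_notMem_finite hN
    have hg' : g⁻¹ ∈ E := hcase g hg hgN
    have hk' : k⁻¹ ∉ E := fun h => hk (by
      simpa using hcase _ h fun hmem => hkN (by simpa [or_comm] using hmem))
    -- `Eᶜ ⊆ E * g` and `E ⊆ Eᶜ * k`: two flips.
    have hflip : ∀ x ∉ E, x * g⁻¹ ∈ E := fun x hx =>
      mem_of_leftBoundary_subset (D := (· * g⁻¹) ⁻¹' E) hW hgen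
        (fun c hc => (hside _ (fun h => hgN (Or.inr h)) c hc).2 hg')
        (hpre g E fun c hc => (hside g (fun h => hgN (Or.inl h)) c hc).2 hg) ha hx
    have hflip' : ∀ x ∈ E, x * k⁻¹ ∉ E := fun x hx => by
      refine mem_of_leftBoundary_subset (E := Eᶜ) (D := ((· * k⁻¹) ⁻¹' E)ᶜ) hW hgen ?_ ?_ ha'
        (not_not.2 hx)
      · rw [leftBoundary_compl]
        exact fun c hc hck => hk' ((hside _ (fun h => hkN (Or.inr h)) c hc).1 hck)
      · rw [leftBoundary_compl]
        exact hpre k Eᶜ fun c hc hck => hk ((hside k (fun h => hkN (Or.inl h)) c hc).1 hck)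
    refine ⟨k⁻¹ * g⁻¹, hW, hgen, hfin, fun x hx => ?_, b * g⁻¹, hflip b hbE, ?_⟩
    · rw [← mul_assoc]
      exact hflip _ (hflip' x hx)
    · have : b * g⁻¹ * (k⁻¹ * g⁻¹)⁻¹ = b * k := by group
      rw [this]
      exact fun h => hk ((hside k (fun h => hkN (Or.inl h)) b hb).1 h)

/-! ### The nested chain of translates -/

namespace IsNestedBy

variable {W E : Set G} {h : G}

theorem mul_pow_mem (H : IsNestedBy W E h) {g : G} (hg : g ∈ E) (n : ℕ) : g * h ^ n ∈ E := by
  induction n with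
  | zero => simpa
  | succ n ih => rw [pow_succ, ← mul_assoc]; exact H.mul_mem _ ih

theorem mul_zpow_mem (H : IsNestedBy W E h) {g : G} {m n : ℤ} (hg : g * h ^ m ∈ E)
    (hmn : m ≤ n) : g * h ^ n ∈ E := by
  obtain ⟨k, rfl⟩ := Int.le.dest hmn
  rw [zpow_add, zpow_natCast, ← mul_assoc]
  exact H.mul_pow_mem hg k

theorem pow (H : IsNestedBy W E h) {k : ℕ} (hk : k ≠ 0) : IsNestedBy W E (h ^ k) where
  inv_mem := H.inv_mem
  closure_eq := H.closure_eq
  finite_leftBoundary := H.finite_leftBoundary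
  mul_mem g hg := H.mul_pow_mem hg k
  exists_notMem := by
    obtain ⟨g, hg, hg'⟩ := H.exists_notMem
    refine ⟨g, hg, fun hmem => hg' ?_⟩
    have := H.mul_zpow_mem (g := g) (m := -k) (n := -1) (by simpa using hmem) (by omega)
    simpa using this

/-- Reversing the translation nests the complement. -/
theorem compl_inv (H : IsNestedBy W E h) : IsNestedBy W Eᶜ h⁻¹ where
  inv_mem := H.inv_mem
  closure_eq := H.closure_eq
  finite_leftBoundary := by rw [leftBoundary_compl]; exact H.finite_leftBoundary
  mul_mem g hg := fun hmem => hg (by simpa using H.mul_mem _ hmem)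
  exists_notMem := by
    obtain ⟨g, hg, hg'⟩ := H.exists_notMem
    exact ⟨g * h⁻¹, hg', by simpa using hg⟩

theorem pow_injective (H : IsNestedBy W E h) : Function.Injective (fun n : ℕ => h ^ n) := by
  refine injective_pow_iff_not_isOfFinOrder.2 fun hfin => ?_
  obtain ⟨n, hn, hpow⟩ := isOfFinOrder_iff_pow_eq_one.1 hfin
  obtain ⟨g, hg, hg'⟩ := (H.pow hn.ne').exists_notMem
  exact hg' (by simpa [hpow] using hg)

/-- The powers of `h` eventually move a finite set off any other finite set. -/
theorem eventually_mul_pow_notMem (H : IsNestedBy W E h) {P Q : Set G} (hP : P.Finite)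
    (hQ : Q.Finite) : ∀ᶠ n : ℕ in atTop, ∀ p ∈ P, p * h ^ n ∉ Q := by
  rw [Filter.eventually_all_finite hP]
  intro p _
  have hfin : {n : ℕ | p * h ^ n ∈ Q}.Finite :=
    hQ.preimage (f := fun n : ℕ => p * h ^ n)
      ((mul_right_injective p).comp H.pow_injective).injOn
  rw [← Nat.cofinite_eq_atTop]
  exact hfin.eventually_cofinite_notMem

/-- The sets `E * h⁻ⁿ` exhaust `G`. -/
theorem exists_mul_pow_mem (H : IsNestedBy W E h) (g : G) : ∃ n : ℕ, g * h ^ n ∈ E := by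
  by_contra! hg
  obtain ⟨a, ha, -⟩ := H.exists_notMem
  refine mem_of_forall_mul_mem (U := {g | ∀ n : ℕ, g * h ^ n ∉ E}) H.inv_mem H.closure_eq ?_ hg a 0
    (by simpa using ha)
  intro s hs u hu n hn
  -- If `u` never enters `E` but `s * u` does, then `u * h ^ m` is in the boundary for all large `m`.
  obtain ⟨m, hm, hnm⟩ := ((H.eventually_mul_pow_notMem (Set.finite_singleton u)
    H.finite_leftBoundary).and (eventually_ge_atTop n)).exists
  refine hm u rfl ⟨s, hs, fun hiff => hu m (hiff.2 ?_)⟩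
  have := H.mul_zpow_mem (g := s * u) (m := n) (n := m) (by simpa using hn) (by exact_mod_cast hnm)
  simpa [mul_assoc] using this

theorem exists_mul_inv_pow_notMem (H : IsNestedBy W E h) (g : G) :
    ∃ n : ℕ, g * (h ^ n)⁻¹ ∉ E := by
  simpa using H.compl_inv.exists_mul_pow_mem g

/-- The `n`-th piece `E hⁿ \ E hⁿ⁺¹` of the partition of `G` cut out by the nested chain. -/
def slab (E : Set G) (h : G) (n : ℤ) : Set G := {g | g * h ^ (-n) ∈ E ∧ g * h ^ (-(n + 1)) ∉ E}

theorem disjoint_slab (H : IsNestedBy W E h) {m n : ℤ} (hmn : m ≠ n) :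
    Disjoint (slab E h m) (slab E h n) := by
  rw [Set.disjoint_left]
  rintro g ⟨h₁, h₂⟩ ⟨h₃, h₄⟩
  rcases lt_or_gt_of_ne hmn with hlt | hlt
  · exact h₂ (H.mul_zpow_mem h₃ (by omega))
  · exact h₄ (H.mul_zpow_mem h₁ (by omega))

theorem exists_mem_slab (H : IsNestedBy W E h) (g : G) : ∃ n, g ∈ slab E h n := by
  obtain ⟨k, hk⟩ := H.exists_mul_pow_mem g
  obtain ⟨l, hl⟩ := H.exists_mul_inv_pow_notMem g
  obtain ⟨n, hn, hmax⟩ := Int.exists_greatest_of_bdd (P := fun n : ℤ => g * h ^ (-n) ∈ E)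
    ⟨l, fun z hz => by
      by_contra! hlt
      exact hl (by simpa using H.mul_zpow_mem (n := -l) hz (by omega))⟩ ⟨-k, by simpa using hk⟩
  exact ⟨n, hn, fun hmem => by have := hmax _ hmem; omega⟩

/-- When the boundary is disjoint from its translate by `h`, only consecutive slabs are joined by
an edge, and such an edge runs along the corresponding translate of the boundary. -/
theorem eq_add_one_of_mem_slab (H : IsNestedBy W E h)
    (hdisj : ∀ b ∈ leftBoundary W E, b * h ∉ leftBoundary W E) {m n : ℤ} (hnm : n < m) {a s : G}
    (hs : s ∈ W) (ha : a ∈ slab E h n) (hb : s * a ∈ slab E h m) :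
    m = n + 1 ∧ a * h ^ (-m) ∈ leftBoundary W E ∧ s * a * h ^ (-m) ∈ leftBoundary W E := by
  have hcross : ∀ k : ℤ, n + 1 ≤ k → k ≤ m →
      ¬(a * h ^ (-k) ∈ E ↔ s * (a * h ^ (-k)) ∈ E) := by
    intro k hnk hkm hiff
    rw [← mul_assoc] at hiff
    exact ha.2 (H.mul_zpow_mem (hiff.2 (H.mul_zpow_mem hb.1 (by omega))) (by omega))
  have hm : m = n + 1 := by
    by_contra hne
    refine hdisj (a * h ^ (-(n + 2))) ⟨s, hs, hcross _ (by omega) (by omega)⟩ ?_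
    have : a * h ^ (-(n + 2)) * h = a * h ^ (-(n + 1)) := by group
    rw [this]
    exact ⟨s, hs, hcross _ (by omega) (by omega)⟩
  have := hcross m (by omega) le_rfl
  exact ⟨hm, ⟨s, hs, this⟩, by rw [mul_assoc]; exact mul_mem_leftBoundary H.inv_mem hs this⟩

theorem isWeaklyPeriodic {X : Type*} [MulAction G X] (H : IsNestedBy W E h) {z : X}
    (hz : h • z = z) : IsWeaklyPeriodic G z := by
  refine (Set.infinite_range_of_injective H.pow_injective).mono ?_
  rintro _ ⟨n, rfl⟩
  exact Subgroup.pow_mem (MulAction.stabilizer G z) hz n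

end IsNestedBy

end HalfSpaces

/-! ### Gluing and periodic points -/

section Gluing

variable {G X : Type*} [Group G] [MetricSpace X] [MulAction G X]

open IsNestedBy in
/-- The gluing step: a point `x` that agrees with `h • x` along the boundary of `E` can be replaced
by an `h`-fixed point that stays close to it over the fundamental domain `E \ E h`. The set `S`
comes from the Markov property. -/
theorem exists_smul_eq_of_boundary_close {δ : ℝ}
    (hδ : ∀ x y : X, x ≠ y → ∃ g : G, δ < dist (g • x) (g • y)) {S W E : Set G} {h : G}
    (hS : ∀ F : ℕ → Set G, Pairwise (fun n m => Disjoint (F n) (F m)) → (⋃ n, F n) = Set.univ →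
      ∀ x : ℕ → X,
        (∀ n m, n ≠ m → ∀ g ∈ (S * F n) ∩ F m, dist (g • x n) (g • x m) ≤ δ / 2) →
        ∃ z : X, ∀ n, ∀ g ∈ F n, dist (g • z) (g • x n) ≤ δ / 2)
    (hSW : S ⊆ W) (H : IsNestedBy W E h)
    (hdisj : ∀ b ∈ leftBoundary W E, b * h ∉ leftBoundary W E) {x : X}
    (hx : ∀ g ∈ leftBoundary W E, dist (g • x) (g • h • x) ≤ δ / 2) :
    ∃ z : X, h • z = z ∧ ∀ g ∈ E, g * h⁻¹ ∉ E → dist (g • z) (g • x) ≤ δ / 2 := by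
  let e : ℕ ≃ ℤ := Equiv.intEquivNat.symm
  have hpair : ∀ n m : ℤ, n < m → ∀ a s, s ∈ W → a ∈ slab E h n → s * a ∈ slab E h m →
      dist (a • h ^ (-m) • x) (a • h ^ (-n) • x) ≤ δ / 2 ∧
      dist ((s * a) • h ^ (-m) • x) ((s * a) • h ^ (-n) • x) ≤ δ / 2 := by
    intro n m hnm a s hs ha hb
    obtain ⟨rfl, h₁, h₂⟩ := H.eq_add_one_of_mem_slab hdisj hnm hs ha hb
    have hpow : h ^ (-n) = h ^ (-(n + 1)) * h := by group
    constructor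
    · have := hx _ h₁
      rwa [mul_smul, mul_smul, smul_smul _ h, ← hpow] at this
    · have := hx _ h₂
      rwa [mul_smul _ (h ^ (-(n + 1))), mul_smul _ (h ^ (-(n + 1))), smul_smul _ h, ← hpow] at this
  obtain ⟨z, hz⟩ := hS (fun n => slab E h (e n))
    (fun n m hnm => H.disjoint_slab (e.injective.ne hnm))
    (Set.eq_univ_of_forall fun g => by
      obtain ⟨n, hn⟩ := H.exists_mem_slab g
      exact Set.mem_iUnion.2 ⟨e.symm n, by simpa using hn⟩)
    (fun n => h ^ (-e n) • x) (by
      rintro n m hnm g ⟨⟨s, hs, a, ha, rfl⟩, hb⟩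
      rcases lt_or_gt_of_ne (e.injective.ne hnm) with hlt | hlt
      · rw [dist_comm]
        exact (hpair _ _ hlt a s (hSW hs) ha hb).2
      · exact (hpair _ _ hlt (s * a) s⁻¹ (H.inv_mem s (hSW hs)) hb (by simpa using ha)).1)
  have hz' : ∀ n : ℤ, ∀ g ∈ slab E h n, dist (g • z) (g • h ^ (-n) • x) ≤ δ / 2 := by
    intro n g hg
    have := hz (e.symm n) g (by simpa using hg)
    simpa using this
  refine ⟨z, ?_, fun g hg hg' => ?_⟩
  · -- `h • z` follows the same glued configuration, since `h` shifts the slabs.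
    by_contra hne
    obtain ⟨g, hg⟩ := hδ _ _ hne
    obtain ⟨n, hn⟩ := H.exists_mem_slab g
    have hpow : ∀ k : ℤ, g * h * h ^ (-(k + 1)) = g * h ^ (-k) := fun k => by group
    have h₁ := hz' n g hn
    have h₂ := hz' (n + 1) (g * h) ⟨by rw [hpow]; exact hn.1, by rw [hpow]; exact hn.2⟩
    rw [smul_smul _ (h ^ (-(n + 1))), hpow, mul_smul g h, mul_smul] at h₂
    have := dist_triangle_right (g • h • z) (g • z) (g • h ^ (-n) • x)
    linarith
  · simpa using hz' 0 g ⟨by simpa using hg, by simpa using hg'⟩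

variable [CompactSpace X] [ContinuousConstSMul G X]

/-- By compactness, some orbit of `h` returns close enough to itself along the boundary for the
gluing step to apply, so some power of `h` has a fixed point. -/
theorem exists_periodic [Nonempty X] {δ : ℝ} (hδ : IsExpansivenessConstant G X δ)
    {S W E : Set G} {h : G}
    (hS : ∀ F : ℕ → Set G, Pairwise (fun n m => Disjoint (F n) (F m)) → (⋃ n, F n) = Set.univ →
      ∀ x : ℕ → X,
        (∀ n m, n ≠ m → ∀ g ∈ (S * F n) ∩ F m, dist (g • x n) (g • x m) ≤ δ / 2) →
        ∃ z : X, ∀ n, ∀ g ∈ F n, dist (g • z) (g • x n) ≤ δ / 2)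
    (hSW : S ⊆ W) (H : IsNestedBy W E h) :
    ∃ k : ℕ, k ≠ 0 ∧ ∃ z : X, h ^ k • z = z := by
  obtain ⟨x⟩ := ‹Nonempty X›
  obtain ⟨a, φ, hφ, ha⟩ := CompactSpace.tendsto_subseq fun n : ℕ => h ^ n • x
  have hclose : ∀ᶠ k in atTop, ∀ g ∈ leftBoundary W E,
      dist (g • h ^ φ k • x) (g • a) < δ / 4 := by
    rw [Filter.eventually_all_finite H.finite_leftBoundary]
    intro g _
    exact Metric.tendsto_nhds.1 (ha.const_smul g) (δ / 4) (by linarith [hδ.1])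
  obtain ⟨k, hk⟩ := hclose.exists
  have hsub : Tendsto (fun l => φ l - φ k) atTop atTop :=
    (tendsto_sub_atTop_nat (φ k)).comp hφ.tendsto_atTop
  obtain ⟨l, hl, hldisj, hkl⟩ := (hclose.and ((hsub.eventually (H.eventually_mul_pow_notMem
    H.finite_leftBoundary H.finite_leftBoundary)).and (eventually_gt_atTop k))).exists
  have hlt : φ k < φ l := hφ hkl
  have hne : φ l - φ k ≠ 0 := by omega
  obtain ⟨z, hz, -⟩ := exists_smul_eq_of_boundary_close hδ.2 hS hSW (H.pow hne) hldisj
    (x := h ^ φ k • x) fun g hg => by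
      rw [smul_smul (h ^ (φ l - φ k)), ← pow_add, Nat.sub_add_cancel hlt.le]
      have := dist_triangle_right (g • h ^ φ k • x) (g • h ^ φ l • x) (g • a)
      linarith [hk g hg, hl g hg]
  exact ⟨_, hne, z, hz⟩

/-- Uniform expansiveness: points that stay `δ`-close along a suitable finite set of translates
are close. -/
theorem exists_finite_forall_dist_lt {δ : ℝ}
    (hδ : ∀ x y : X, x ≠ y → ∃ g : G, δ < dist (g • x) (g • y)) {ε : ℝ} (hε : 0 < ε) :
    ∃ A : Set G, A.Finite ∧
      ∀ x y : X, (∀ g ∈ A, dist (g • x) (g • y) ≤ δ) → dist x y < ε := by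
  have hK : IsCompact {p : X × X | ε ≤ dist p.1 p.2} :=
    (isClosed_le continuous_const continuous_dist).isCompact
  obtain ⟨A, hA⟩ := hK.elim_finite_subcover
    (fun g : G => {p : X × X | δ < dist (g • p.1) (g • p.2)})
    (fun g => isOpen_lt continuous_const
      ((continuous_fst.const_smul g).dist (continuous_snd.const_smul g)))
    (fun p hp => Set.mem_iUnion.2 (hδ p.1 p.2 fun heq => by
      simp only [Set.mem_ofPred_eq, heq, dist_self] at hp
      linarith))
  refine ⟨A, A.finite_toSet, fun x y hxy => ?_⟩
  by_contra! hle
  obtain ⟨g, hg, hlt⟩ := Set.mem_iUnion₂.1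
    (hA (show (x, y) ∈ {p : X × X | ε ≤ dist p.1 p.2} from hle))
  exact (hxy g hg).not_gt hlt

end Gluing

theorem theorem3p3 {G X : Type*} [Group G] [Group.FG G] (hends : HasAtLeastTwoEnds G)
    [MetricSpace X] [CompactSpace X] [Nonempty X] [MulAction G X] [ContinuousConstSMul G X]
    (δ : ℝ) (hδ : IsExpansivenessConstant G X δ)
    (hMarkov : CoverStrongTopologicalMarkov G X δ) :
    (∃ x : X, IsWeaklyPeriodic G x) ∧
      (WeakSpecification G X → Dense {x : X | IsWeaklyPeriodic G x}) := by
  obtain ⟨E, hE, hEc, hinv⟩ := exists_halfSpace hends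
  obtain ⟨T, hT, hgen, -⟩ := hends
  obtain ⟨S, hSfin, hSsymm, -, hS⟩ := hMarkov
  let W : Set G := S ∪ (T ∪ T⁻¹)
  have hW : ∀ s ∈ W, s⁻¹ ∈ W := by
    rintro s (hs | hs | hs)
    · exact Or.inl (by rw [← hSsymm]; simpa using hs)
    · exact Or.inr (Or.inr (by simpa using hs))
    · exact Or.inr (Or.inl hs)
  have hWgen : Subgroup.closure W = ⊤ :=
    top_le_iff.1 (hgen ▸ Subgroup.closure_mono fun t ht => Or.inr (Or.inl ht))
  have hfin : (leftBoundary W E).Finite := by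
    refine ((hSfin.union (hT.union hT.inv)).biUnion fun s _ => hinv s).subset ?_
    rintro v ⟨s, hs, hv⟩
    exact Set.mem_biUnion hs hv
  have hSW : S ⊆ W := Set.subset_union_left
  obtain ⟨h₀, H₀⟩ := exists_isNestedBy hW hWgen hfin hE hEc
  obtain ⟨k, hk, z₀, hz₀⟩ := exists_periodic hδ hS hSW H₀
  have H := H₀.pow hk
  set h := h₀ ^ k
  refine ⟨⟨z₀, H.isWeaklyPeriodic hz₀⟩, fun hspec => Metric.dense_iff.2 fun x ε hε => ?_⟩
  have hpos := hδ.1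
  obtain ⟨A, hA, hAε⟩ := exists_finite_forall_dist_lt (X := X) hδ.2 hε
  obtain ⟨R, hR, -, hspec⟩ := hspec (δ / 4) (by linarith)
  have hB := H.finite_leftBoundary
  have hRA : (R * A).Finite := hR.mul hA
  -- For large `m`, the set `A` lies in `E h⁻ᵐ \ E hᵐ`, and `R * A` avoids both boundaries.
  have hin : ∀ᶠ m : ℕ in atTop, ∀ g ∈ A, g * h ^ m ∈ E := by
    rw [Filter.eventually_all_finite hA]
    intro g _
    obtain ⟨n, hn⟩ := H.exists_mul_pow_mem g
    filter_upwards [eventually_ge_atTop n] with m hm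
    simpa using H.mul_zpow_mem (g := g) (m := n) (n := m) (by simpa using hn) (by exact_mod_cast hm)
  have hout : ∀ᶠ m : ℕ in atTop, ∀ g ∈ A, g * (h ^ m)⁻¹ ∉ E := by
    rw [Filter.eventually_all_finite hA]
    intro g _
    obtain ⟨n, hn⟩ := H.exists_mul_inv_pow_notMem g
    filter_upwards [eventually_ge_atTop n] with m hm hmem
    refine hn ?_
    simpa using H.mul_zpow_mem (g := g) (m := -m) (n := -n) (by simpa using hmem) (by omega)
  obtain ⟨m, hm₀, hin, hout, hd₁, hd₂, hd₃⟩ := ((eventually_gt_atTop 0).and (hin.and (hout.and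
    ((H.eventually_mul_pow_notMem hRA hB).and ((H.eventually_mul_pow_notMem hB hRA).and
    ((H.pow two_ne_zero).eventually_mul_pow_notMem hB hB)))))).exists
  rw [← pow_mul] at hd₃
  have hz₀m : h ^ m • z₀ = z₀ := Subgroup.pow_mem (MulAction.stabilizer G z₀) hz₀ m
  have hz₀m' : (h ^ m)⁻¹ • z₀ = z₀ := by rw [inv_smul_eq_iff, hz₀m]
  let B := leftBoundary W E
  obtain ⟨y, hyA, hyB⟩ := hspec A ({g | g * h ^ m ∈ B} ∪ {g | g * (h ^ m)⁻¹ ∈ B}) x z₀ (by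
    rw [Set.eq_empty_iff_forall_notMem]
    rintro g ⟨hg, hg' | hg'⟩
    · exact hd₁ g hg hg'
    · exact hd₂ _ hg' (by simpa using hg))
  have hmm : h ^ (2 * m) * (h ^ m)⁻¹ = h ^ m := by rw [two_mul, pow_add]; group
  obtain ⟨z, hz, hzy⟩ := exists_smul_eq_of_boundary_close hδ.2 hS hSW
    (H.pow (k := 2 * m) (by omega)) hd₃ (x := (h ^ m)⁻¹ • y) fun g hg => by
      have h₁ := hyB (g * (h ^ m)⁻¹) (Or.inl (by simpa using hg))
      have h₂ := hyB (g * h ^ m) (Or.inr (by simpa using hg))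
      rw [mul_smul, mul_smul, hz₀m'] at h₁
      rw [mul_smul, mul_smul, hz₀m] at h₂
      rw [smul_smul (h ^ (2 * m)), hmm]
      have := dist_triangle_left (g • (h ^ m)⁻¹ • y) (g • h ^ m • y) (g • z₀)
      linarith
  refine ⟨h ^ m • z, ?_, (H.pow (k := 2 * m) (by omega)).isWeaklyPeriodic ?_⟩
  · rw [Metric.mem_ball]
    refine hAε _ _ fun g hg => ?_
    have h₁ := hyA g hg
    have h₂ := hzy (g * h ^ m) (hin g hg) (by
      have : g * h ^ m * (h ^ (2 * m))⁻¹ = g * (h ^ m)⁻¹ := by rw [two_mul, pow_add]; group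
      rw [this]
      exact hout g hg)
    rw [mul_smul, mul_smul, smul_inv_smul] at h₂
    have := dist_triangle_right (g • h ^ m • z) (g • x) (g • y)
    linarith
  · rw [smul_smul, ← pow_add, add_comm, pow_add, mul_smul, hz]
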